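/- Let $N\in\mathbb N$ and $c>0$, let $H_N$ be the Hermite polynomial of degree $N$, $H_n(x)=(-1)^n e^{x^2}\frac{d^n}{dx^n}e^{-x^2}$ (orthogonal with respect to $e^{-x^2}$), and let $z=(z_1,\dots,z_N)$ with $z_1>\dots>z_N$ be the vector of its zeros. Let $\phi(t)=\phi(t,cz)$, $t\ge 0$, be the solution of $$\frac{dx_i}{dt}(t)=\sum_{j\ne i}\frac{1}{x_i(t)-x_j(t)}\quad(i=1,\dots,N),\qquad x(0)=c\,z,$$ in the open Weyl chamber $\{x\in\mathbb R^N: x_1>\dots>x_N\}$. Let $(B_t)_{t\ge0}$ be an $N$-dimensional standard Brownian motion, and let $(W_t)_{t\ge0}$ be the process of type $A_{N-1}$ attached to the starting points $\sqrt k\,cz+y$ (it does not depend on $y\in\mathbb R^N$), i.e. the solution with continuous paths of the linear SDE $$dW_t^i=dB_t^i+\sum_{j\ne i}\frac{W_t^j-W_t^i}{(\phi_i(t)-\phi_j(t))^2}\,dt\quad(i=1,\dots,N),\qquad W_0=0.$$ Let $E$ be the $N\times N$ unit matrix and let $A\in\mathbb R^{N\times N}$ be given by $A_{i,j}=\frac{1}{(z_i-z_j)^2}$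 for $i\ne j$ and $A_{i,i}=-\sum_{j\ne i}\frac{1}{(z_i-z_j)^2}$. Then, for every $t>0$, the components of $W_t$ are square-integrable, $E-A$ is invertible, and the covariance matrix of $W_t$ is $$\Sigma_t=\Bigl(t+\frac{c^2}{2}\Bigr)(E-A)^{-1}\Bigl(E-e^{\left(\ln\frac{c^2}{2t+c^2}\right)(E-A)}\Bigr).$$ The eigenvalues of $\Sigma_t$, counted with multiplicity, are $$\lambda_j(t,c)=\frac{1}{2j}\,\frac{(2t+c^2)^j-c^{2j}}{(2t+c^2)^{j-1}}\qquad(j=1,\dots,N),$$ and $\lambda_1(t,c)=t$. -/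

import Mathlib

open MeasureTheory ProbabilityTheory
open scoped NNReal Matrix

noncomputable section

namespace BesselA

/-- The Hermite polynomials orthogonal with respect to the density `exp (-x ^ 2)`, normalized as
`H_n (x) = (-1) ^ n * exp (x ^ 2) * (d / dx) ^ n exp (-x ^ 2)`; this Rodrigues formula is the
recursion `H_0 = 1`, `H_{n+1} = 2 x H_n - H_n'`. -/
def physHermite : ℕ → Polynomial ℝ
  | 0 => 1
  | n + 1 => 2 * Polynomial.X * physHermite n - Polynomial.derivative (physHermite n)

/-- `z = (z_1, …, z_N)` lists exactly the zeros of `H_N`, in decreasing order. -/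
def IsOrderedHermiteZeros {N : ℕ} (z : Fin N → ℝ) : Prop :=
  StrictAnti z ∧ ∀ x : ℝ, (physHermite N).IsRoot x ↔ x ∈ Set.range z

/-- The interior of the closed Weyl chamber `{x | x_1 ≥ x_2 ≥ … ≥ x_N}` of type `A_{N-1}`. -/
def openChamber (N : ℕ) : Set (Fin N → ℝ) :=
  {x | StrictAnti x}

/-- The vector field `H (x)_i = ∑_{j ≠ i} 1 / (x_i - x_j)`. -/
def drift {N : ℕ} (x : Fin N → ℝ) : Fin N → ℝ :=
  fun i => ∑ j ∈ Finset.univ.erase i, 1 / (x i - x j)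

/-- `φ` (restricted to `[0, ∞)`) is the solution of `dx/dt = H (x)` in the open Weyl chamber with
starting point `x₀`. -/
structure IsFrozenSolution {N : ℕ} (φ : ℝ → Fin N → ℝ) (x₀ : Fin N → ℝ) : Prop where
  init : φ 0 = x₀
  mem_chamber : ∀ t : ℝ, 0 ≤ t → φ t ∈ openChamber N
  hasDeriv : ∀ t : ℝ, 0 ≤ t → HasDerivWithinAt φ (drift (φ t)) (Set.Ici 0) t

/-- The matrix with entries `1 / (x_i - x_j) ^ 2` off the diagonal and
`- ∑_{j ≠ i} 1 / (x_i - x_j) ^ 2` on the diagonal. -/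
def interactionMatrix {N : ℕ} (x : Fin N → ℝ) : Matrix (Fin N) (Fin N) ℝ :=
  Matrix.of fun i j =>
    if i = j then -∑ l ∈ Finset.univ.erase i, 1 / (x i - x l) ^ 2 else 1 / (x i - x j) ^ 2

variable {Ω : Type*} [MeasurableSpace Ω]

/-- A standard `N`-dimensional Brownian motion (started in `0`): its components are independent
standard real Brownian motions. -/
structure IsBrownianVec {N : ℕ} (B : Fin N → ℝ≥0 → Ω → ℝ) (P : Measure Ω) : Prop where
  brownian : ∀ i, IsBrownianReal (B i) P
  indep : iIndepFun (fun i ω t => B i t ω) P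

/-- `W` is a solution with continuous paths of the linear SDE
`dW_t = dB_t + A (t) W_t dt`, `W_0 = 0`, where `A (t) = interactionMatrix (φ t)`. The noise is
additive, so almost surely this is the integral equation `W_t = B_t + ∫₀ᵗ A (s) W_s ds`. -/
structure IsFluctuationProcess {N : ℕ} (φ : ℝ → Fin N → ℝ) (B : Fin N → ℝ≥0 → Ω → ℝ)
    (W : ℝ≥0 → Ω → Fin N → ℝ) (P : Measure Ω) : Prop where
  continuous : ∀ᵐ ω ∂P, Continuous fun t => W t ω
  init : ∀ᵐ ω ∂P, W 0 ω = 0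
  sde : ∀ᵐ ω ∂P, ∀ (t : ℝ≥0) (i : Fin N),
    W t ω i = B i t ω + ∫ s in (0 : ℝ)..t, (interactionMatrix (φ s) *ᵥ W s.toNNReal ω) i

/-- The covariance matrix of a random vector. -/
def covMatrix {N : ℕ} (Y : Ω → Fin N → ℝ) (P : Measure Ω) : Matrix (Fin N) (Fin N) ℝ :=
  Matrix.of fun i j => cov[fun ω => Y ω i, fun ω => Y ω j; P]

/-- `λ_j (t, c) = (1 / (2 j)) * ((2 t + c ^ 2) ^ j - c ^ (2 j)) / (2 t + c ^ 2) ^ (j - 1)`,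
for `j ≥ 1`. -/
def covEigenvalue (j : ℕ) (t c : ℝ) : ℝ :=
  1 / (2 * (j : ℝ)) * (((2 * t + c ^ 2) ^ j - c ^ (2 * j)) / (2 * t + c ^ 2) ^ (j - 1))

end BesselA

end

noncomputable section

namespace BesselA

/-! The Hermite differential equation at a simple root says that the zeros are in equilibrium,
`drift z = z`. As the drift is homogeneous of degree `-1`, `√(2t + c²) • z` solves the frozen
equation, and monotonicity of the drift makes it the only solution. The SDE therefore has
coefficient `(2t + c²)⁻¹ A` with one fixed symmetric `A = interactionMatrix z`.

A single orthonormal eigenbasis of `A` decouples the SDE for all times into scalar equations `dw =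
dβ + μ w / (2t + c²) dt`. With the integrating factor `g(t) = (2t + c²)^(-μ/2)`, the solution is
`g(t)⁻¹ ∫ g dβ`; its variance `g(t)⁻² ∫₀ᵗ g²` is elementary, and different eigendirections are
uncorrelated. Reassembling in the eigenbasis gives the asserted function of `A`.

The spectrum is explicit: on the vectors `(z_j ^ k)_j`, `k < N`, the matrix `A` acts triangularly
with diagonal entry `-k` (`eval_interactionPoly`). So `1 - μ` runs through `1, …, N`.

The integrands `g` are deterministic and continuously differentiable, so the stochastic integral is
defined pathwise by parts, and its isometry follows by Fubini from the covariance `κ min(s, r)`. -/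

/-! ### Hermite polynomials and the equilibrium of their zeros -/

open Polynomial in
lemma derivative_physHermite_succ (n : ℕ) :
    derivative (physHermite (n + 1)) = C (2 * ((n : ℝ) + 1)) * physHermite n := by
  induction n with
  | zero => simp [physHermite]; simp [← C_ofNat]
  | succ n ih =>
    rw [physHermite, derivative_sub, derivative_mul, ih, derivative_C_mul, physHermite]
    simp only [derivative_mul, derivative_X, derivative_ofNat, map_mul, map_add, map_one, map_natCast,
      Nat.cast_add, Nat.cast_one]
    simp only [map_ofNat]
    ring

-- No second induction is needed: expand `H_{n+1}'` by the defining recursion and compare with `2 (n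
-- + 1) H_n`.
open Polynomial in
lemma physHermite_ode (n : ℕ) :
    derivative (derivative (physHermite n)) - 2 * X * derivative (physHermite n)
      + C (2 * (n : ℝ)) * physHermite n = 0 := by
  have h := derivative_physHermite_succ n
  rw [physHermite, derivative_sub, derivative_mul] at h
  simp only [derivative_mul, derivative_X, derivative_ofNat, map_mul, map_add, map_one, map_natCast,
    map_ofNat] at h ⊢
  linear_combination -h

open Polynomial in
lemma natDegree_physHermite_le (n : ℕ) : (physHermite n).natDegree ≤ n := by
  induction n with
  | zero => simp [physHermite]
  | succ n ih =>
    rw [physHermite]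
    refine (natDegree_sub_le _ _).trans (max_le ?_ ?_)
    · rw [mul_assoc, ← C_ofNat]
      refine (natDegree_C_mul_le _ _).trans ((natDegree_mul_le).trans ?_)
      have := natDegree_X_le (R := ℝ)
      omega
    · have := natDegree_derivative_le (physHermite n)
      omega

open Polynomial in
lemma coeff_physHermite_self (n : ℕ) : (physHermite n).coeff n = 2 ^ n := by
  induction n with
  | zero => simp [physHermite]
  | succ n ih =>
    rw [physHermite, coeff_sub, mul_assoc, ← C_ofNat, coeff_C_mul, coeff_X_mul, ih,
      coeff_derivative, coeff_eq_zero_of_natDegree_lt]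
    · ring
    · have := natDegree_physHermite_le n
      omega

-- The hypothesis gives the roots only as a set; they are simple by counting, since `N` distinct
-- roots already exhaust the degree.
open Polynomial in
lemma physHermite_eq_prod {N : ℕ} {z : Fin N → ℝ} (hz : IsOrderedHermiteZeros z) :
    physHermite N = C (2 ^ N) * ∏ i, (X - C (z i)) := by
  have hdeg : (physHermite N).natDegree = N :=
    le_antisymm (natDegree_physHermite_le N)
      (le_natDegree_of_ne_zero (by rw [coeff_physHermite_self]; positivity))
  have h0 : physHermite N ≠ 0 := by
    intro h
    have := coeff_physHermite_self N
    rw [h, coeff_zero] at this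
    exact (pow_ne_zero N two_ne_zero) this.symm
  have hle : Finset.univ.val.map z ≤ (physHermite N).roots := by
    rw [Multiset.le_iff_subset (Multiset.Nodup.map hz.1.injective Finset.univ.nodup)]
    intro x hx
    rw [mem_roots h0, hz.2]
    simpa using hx
  have hroots : Finset.univ.val.map z = (physHermite N).roots := by
    refine Multiset.eq_of_le_of_card_le hle ?_
    refine (card_roots' _).trans ?_
    simp [hdeg]
  have hlead : (physHermite N).leadingCoeff = 2 ^ N := by
    rw [leadingCoeff, hdeg, coeff_physHermite_self]
  have := C_leadingCoeff_mul_prod_multiset_X_sub_C (p := physHermite N) (by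
    rw [← hroots, hdeg]; simp)
  rw [← this, hlead, ← hroots, Multiset.map_map]
  rfl

open Polynomial in
/-- The zeros of the Hermite polynomial are in electrostatic equilibrium. -/
lemma drift_hermiteZeros {N : ℕ} {z : Fin N → ℝ} (hz : IsOrderedHermiteZeros z) :
    drift z = z := by
  funext i
  -- For `P = 2^N (X - z_i) Q` one has `P'(z_i) = 2^N Q(z_i)` and `P''(z_i) = 2 · 2^N Q'(z_i)`, so
  -- the differential equation at `z_i` reads `Q'(z_i) = z_i Q(z_i)`, while `Q'/Q` at `z_i` is the
  -- drift.
  set Q : ℝ[X] := ∏ j ∈ Finset.univ.erase i, (X - C (z j)) with hQ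
  have hP : physHermite N = C (2 ^ N) * ((X - C (z i)) * Q) := by
    rw [physHermite_eq_prod hz, hQ,
      Finset.mul_prod_erase _ (fun j => X - C (z j)) (Finset.mem_univ i)]
  have hQi : Q.eval (z i) ≠ 0 := by
    rw [hQ, eval_prod, Finset.prod_ne_zero_iff]
    intro j hj
    simpa [sub_eq_zero] using fun h => (Finset.ne_of_mem_erase hj) (hz.1.injective h).symm
  have h := congrArg (eval (z i)) (physHermite_ode N)
  rw [hP] at h
  simp only [derivative_mul, derivative_add, derivative_sub, derivative_X,
    derivative_C, derivative_zero, sub_zero, one_mul, eval_add, eval_sub, eval_mul, eval_C, eval_X, sub_self,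
    zero_mul, mul_zero, add_zero, eval_zero, eval_ofNat] at h
  have hd : Q.derivative.eval (z i) = drift z i * Q.eval (z i) := by
    rw [hQ, derivative_prod_finset, eval_finsetSum, drift, Finset.sum_mul, eval_prod]
    refine Finset.sum_congr rfl fun j hj => ?_
    have hne : z i - z j ≠ 0 :=
      sub_ne_zero.2 fun h => (Finset.ne_of_mem_erase hj) (hz.1.injective h).symm
    rw [eval_mul, eval_prod, ← Finset.mul_prod_erase _ _ hj]
    simp
    field_simp
  rw [hd] at h
  have h2 : (2 : ℝ) ^ N ≠ 0 := by positivity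
  have h3 : (2 : ℝ) ^ N * Q.eval (z i) * 2 * (drift z i - z i) = 0 := by linear_combination h
  have h4 : (2 : ℝ) ^ N * Q.eval (z i) * 2 ≠ 0 := by positivity
  exact sub_eq_zero.1 ((mul_eq_zero.1 h3).resolve_left h4)

/-! ### Spectrum of the interaction matrix at the Hermite zeros -/

open Polynomial in
/-- The polynomial `q` in `x` with `y ^ k - x ^ k - k x ^ (k - 1) (y - x) = (y - x) ^ 2 q`. -/
def taylorQuot (y : ℝ[X]) : ℕ → ℝ[X]
  | 0 => 0
  | k + 1 => y * taylorQuot y k + C (k : ℝ) * X ^ (k - 1)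

open Polynomial in
lemma sq_mul_eval_taylorQuot (x : ℝ) (y : ℝ[X]) (k : ℕ) :
    (y.eval x - x) ^ 2 * (taylorQuot y k).eval x
      = (y.eval x) ^ k - x ^ k - k * x ^ (k - 1) * (y.eval x - x) := by
  induction k with
  | zero => simp [taylorQuot]
  | succ k ih =>
    simp only [taylorQuot, eval_add, eval_mul, eval_C, eval_pow, eval_X, Nat.cast_add, Nat.cast_one,
      Nat.add_sub_cancel]
    rcases k with _ | k
    · simp at ih ⊢
      rcases ih with h | h <;> simp [h, taylorQuot]
    · simp only [Nat.add_sub_cancel, Nat.cast_add, Nat.cast_one] at ih ⊢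
      linear_combination y.eval x * ih

-- Lets the term `j = i`, absent from the interaction sum, be removed by subtracting the same
-- polynomial `taylorQuot X k` for every `i`.
open Polynomial in
lemma eval_taylorQuot_X (x : ℝ) (k : ℕ) :
    (taylorQuot X k).eval x = (taylorQuot (C x) k).eval x := by
  induction k with
  | zero => simp [taylorQuot]
  | succ k ih => simp [taylorQuot, ih]

-- This degree bound, applied with `y = C (z j)` and `y = X`, is the source of the triangular form.
open Polynomial in
lemma degree_taylorQuot_lt {y : ℝ[X]} (hy : y.degree ≤ 1) (k : ℕ) :
    (taylorQuot y k).degree < k := by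
  induction k with
  | zero => simp [taylorQuot]
  | succ k ih =>
    rw [taylorQuot]
    refine (degree_add_le _ _).trans_lt (max_lt ?_ ?_)
    · by_cases h : taylorQuot y k = 0
      · simp only [h, mul_zero, degree_zero]
        exact WithBot.bot_lt_coe _
      · rw [degree_eq_natDegree h] at ih
        have hy' : y.natDegree ≤ 1 := natDegree_le_of_degree_le hy
        have ih' : (taylorQuot y k).natDegree < k := by exact_mod_cast ih
        refine degree_le_natDegree.trans_lt ?_
        have := natDegree_mul_le (p := y) (q := taylorQuot y k)
        exact_mod_cast (by omega : (y * taylorQuot y k).natDegree < k + 1)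
    · refine (degree_C_mul_X_pow_le _ _).trans_lt ?_
      exact_mod_cast (by omega : k - 1 < k + 1)

open Polynomial in
/-- The action of the interaction matrix on the monomial `x ^ k`. -/
def interactionPoly {N : ℕ} (z : Fin N → ℝ) (k : ℕ) : ℝ[X] :=
  (∑ j, taylorQuot (C (z j)) k) - taylorQuot X k - C (k : ℝ) * X ^ k

open Polynomial in
lemma degree_interactionPoly_add_lt {N : ℕ} (z : Fin N → ℝ) (k : ℕ) :
    ((∑ j, taylorQuot (C (z j)) k) - taylorQuot X k).degree < k := by
  refine (degree_sub_le _ _).trans_lt (max_lt ?_ (degree_taylorQuot_lt degree_X_le k))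
  refine (degree_sum_le _ _).trans_lt ?_
  refine (Finset.sup_lt_iff (WithBot.bot_lt_coe _)).2 fun j _ => ?_
  exact degree_taylorQuot_lt (degree_C_le.trans zero_le_one) k

open Polynomial in
lemma coeff_interactionPoly_self {N : ℕ} (z : Fin N → ℝ) (k : ℕ) :
    (interactionPoly z k).coeff k = -k := by
  rw [interactionPoly, coeff_sub, coeff_eq_zero_of_degree_lt (degree_interactionPoly_add_lt z k)]
  simp

open Polynomial in
lemma coeff_interactionPoly_of_lt {N : ℕ} (z : Fin N → ℝ) {k m : ℕ} (h : k < m) :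
    (interactionPoly z k).coeff m = 0 := by
  rw [interactionPoly, coeff_sub, coeff_eq_zero_of_degree_lt
    ((degree_interactionPoly_add_lt z k).trans (by exact_mod_cast h))]
  simp [coeff_X_pow, h.ne']

-- The right side is `∑_{j ≠ i} (z_j^k - z_i^k) / (z_i - z_j)^2`. Taylor expansion at `z_i` splits
-- each term into a polynomial quotient and `-k z_i^(k-1) / (z_i - z_j)`; by equilibrium the latter
-- sum to `-k z_i^k`, the leading term.
open Polynomial in
lemma eval_interactionPoly {N : ℕ} {z : Fin N → ℝ} (hz : IsOrderedHermiteZeros z) (i : Fin N)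
    (k : ℕ) :
    (interactionPoly z k).eval (z i) = ∑ j, interactionMatrix z i j * z j ^ k := by
  have hs : ∑ j, (taylorQuot (C (z j)) k).eval (z i) - (taylorQuot X k).eval (z i)
      = ∑ j ∈ Finset.univ.erase i, (taylorQuot (C (z j)) k).eval (z i) := by
    rw [eval_taylorQuot_X, ← Finset.sum_erase_add _ _ (Finset.mem_univ i), add_sub_cancel_right]
  rw [interactionPoly, eval_sub, eval_sub, eval_finsetSum, hs,
    ← Finset.sum_erase_add _ _ (Finset.mem_univ i)]
  have h1 : ∀ j ∈ Finset.univ.erase i, (taylorQuot (C (z j)) k).eval (z i)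
      = interactionMatrix z i j * z j ^ k - 1 / (z i - z j) ^ 2 * z i ^ k
        + k * z i ^ (k - 1) * (1 / (z i - z j)) := by
    intro j hj
    have hji := Finset.ne_of_mem_erase hj
    have hne : z i - z j ≠ 0 := sub_ne_zero.2 fun h => hji (hz.1.injective h).symm
    have := sq_mul_eval_taylorQuot (z i) (C (z j)) k
    rw [eval_C] at this
    simp only [interactionMatrix, Matrix.of_apply, if_neg hji.symm]
    field_simp
    linear_combination this
  rw [Finset.sum_congr rfl h1, Finset.sum_add_distrib, Finset.sum_sub_distrib, ← Finset.mul_sum,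
    ← Finset.sum_mul]
  have h2 : ∑ j ∈ Finset.univ.erase i, 1 / (z i - z j) = z i := congrFun (drift_hermiteZeros hz) i
  rw [h2]
  simp only [interactionMatrix, Matrix.of_apply, if_true, eval_mul, eval_C, eval_pow, eval_X]
  rcases k with _ | k
  · simp
  · simp only [Nat.add_sub_cancel]
    ring

open Polynomial in
lemma interactionMatrix_mul_vandermonde {N : ℕ} {z : Fin N → ℝ} (hz : IsOrderedHermiteZeros z) :
    interactionMatrix z * Matrix.vandermonde z = Matrix.vandermonde z *
      Matrix.of fun m k : Fin N => (interactionPoly z k).coeff m := by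
  ext i k
  simp only [Matrix.mul_apply, Matrix.vandermonde_apply, Matrix.of_apply]
  rw [← eval_interactionPoly hz, eval_eq_sum_range' (n := N), ← Fin.sum_univ_eq_sum_range
    (fun m => (interactionPoly z k).coeff m * z i ^ m)]
  · exact Finset.sum_congr rfl fun m _ => mul_comm _ _
  · have : (interactionPoly z k).natDegree ≤ k :=
      natDegree_le_iff_coeff_eq_zero.2 fun m hm => coeff_interactionPoly_of_lt z hm
    omega

-- The Vandermonde matrix of the distinct zeros is invertible and conjugates `interactionMatrix z`
-- to an upper triangular matrix with diagonal `0, -1, …, -(N - 1)`.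
open Polynomial in
lemma charpoly_interactionMatrix {N : ℕ} {z : Fin N → ℝ} (hz : IsOrderedHermiteZeros z) :
    (interactionMatrix z).charpoly = ∏ k : Fin N, (X - C (-(k : ℝ))) := by
  set T : Matrix (Fin N) (Fin N) ℝ := Matrix.of fun m k => (interactionPoly z k).coeff m with hT
  have hV : IsUnit (Matrix.vandermonde z) := by
    rw [Matrix.isUnit_iff_isUnit_det]
    exact (Matrix.det_vandermonde_ne_zero_iff.2 hz.1.injective).isUnit
  obtain ⟨V, hV⟩ := hV
  have h : interactionMatrix z = (V : Matrix _ _ ℝ) * T * ((V⁻¹ : (Matrix _ _ ℝ)ˣ) : Matrix _ _ ℝ) := by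
    rw [Units.eq_mul_inv_iff_mul_eq, hV]
    exact interactionMatrix_mul_vandermonde hz
  rw [h, Matrix.coe_units_inv, Matrix.charpoly_units_conj, Matrix.charpoly_of_isUpperTriangular]
  · exact Finset.prod_congr rfl fun k _ => by simp [hT, coeff_interactionPoly_self]
  · intro m k hmk
    exact coeff_interactionPoly_of_lt z hmk

lemma isHermitian_interactionMatrix {N : ℕ} (z : Fin N → ℝ) :
    (interactionMatrix z).IsHermitian := by
  ext i j
  simp only [interactionMatrix, Matrix.conjTranspose_apply, Matrix.of_apply, star_trivial]
  by_cases h : i = j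
  · simp [h]
  · rw [if_neg h, if_neg (Ne.symm h), ← neg_sub, neg_sq]

lemma map_eigenvalues_interactionMatrix {N : ℕ} {z : Fin N → ℝ} (hz : IsOrderedHermiteZeros z) :
    Finset.univ.val.map (isHermitian_interactionMatrix z).eigenvalues
      = Finset.univ.val.map fun k : Fin N => -(k : ℝ) := by
  have h := (isHermitian_interactionMatrix z).roots_charpoly_eq_eigenvalues
  rw [charpoly_interactionMatrix hz, Polynomial.roots_prod _ _
    (Finset.prod_ne_zero_iff.2 fun k _ => Polynomial.X_sub_C_ne_zero _)] at h
  simp only [Polynomial.roots_X_sub_C, Multiset.bind_singleton] at h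
  exact h.symm

/-! ### The frozen dynamics -/

lemma drift_eq_sum_univ {N : ℕ} (x : Fin N → ℝ) (i : Fin N) :
    drift x i = ∑ j, 1 / (x i - x j) := by
  rw [drift, ← Finset.sum_erase_add _ _ (Finset.mem_univ i)]
  simp

/-- The drift is the gradient of a concave function on the Weyl chamber, hence monotone. -/
lemma sum_sub_mul_drift_sub_nonpos {N : ℕ} {x y : Fin N → ℝ} (hx : StrictAnti x)
    (hy : StrictAnti y) : ∑ i, (x i - y i) * (drift x i - drift y i) ≤ 0 := by
  set f : Fin N → Fin N → ℝ := fun i j => 1 / (x i - x j) - 1 / (y i - y j) with hf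
  have h1 : ∑ i, (x i - y i) * (drift x i - drift y i) = ∑ i, ∑ j, (x i - y i) * f i j := by
    refine Finset.sum_congr rfl fun i _ => ?_
    rw [drift_eq_sum_univ, drift_eq_sum_univ, ← Finset.sum_sub_distrib, Finset.mul_sum]
  -- `f` is antisymmetric, so averaging over the swap of `i` and `j` leaves products `(a - b) (1/a -
  -- 1/b)` with `a = x i - x j`, `b = y i - y j`; for `i ≠ j` these have the same sign, both points
  -- lying in the chamber.
  have h2 : ∑ i, ∑ j, (x i - y i) * f i j = ∑ i, ∑ j, -((x j - y j) * f i j) := by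
    rw [Finset.sum_comm]
    refine Finset.sum_congr rfl fun i _ => Finset.sum_congr rfl fun j _ => ?_
    simp only [hf]
    rw [← neg_sub (x i), ← neg_sub (y i), div_neg, div_neg]
    ring
  have h3 : 2 * ∑ i, (x i - y i) * (drift x i - drift y i)
      = ∑ i, ∑ j, ((x i - y i) - (x j - y j)) * f i j := by
    rw [two_mul]
    nth_rw 2 [h1]
    rw [h1, h2, ← h2]
    nth_rw 2 [h2]
    simp_rw [← Finset.sum_add_distrib]
    refine Finset.sum_congr rfl fun i _ => Finset.sum_congr rfl fun j _ => by ring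
  have h4 : ∑ i, ∑ j, ((x i - y i) - (x j - y j)) * f i j ≤ 0 := by
    refine Finset.sum_nonpos fun i _ => Finset.sum_nonpos fun j _ => ?_
    have key : ∀ a b : ℝ, 0 < a * b → (a - b) * (1 / a - 1 / b) ≤ 0 := by
      intro a b hab
      have ha : a ≠ 0 := left_ne_zero_of_mul hab.ne'
      have hb : b ≠ 0 := right_ne_zero_of_mul hab.ne'
      have : (a - b) * (1 / a - 1 / b) = -((a - b) ^ 2 / (a * b)) := by
        field_simp
        ring
      rw [this]
      have := div_nonneg (sq_nonneg (a - b)) hab.le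
      linarith
    have hsub : (x i - y i) - (x j - y j) = (x i - x j) - (y i - y j) := by ring
    rw [hsub]
    rcases lt_trichotomy i j with h | h | h
    · exact key _ _ (mul_pos (sub_pos.2 (hx h)) (sub_pos.2 (hy h)))
    · simp [h]
    · exact key _ _ (mul_pos_of_neg_of_neg (sub_neg.2 (hx h)) (sub_neg.2 (hy h)))
  linarith

/-- By monotonicity of the drift the squared distance of two solutions is nonincreasing. No
Lipschitz bound on the drift, singular at the walls, is required. -/
lemma IsFrozenSolution.unique {N : ℕ} {φ ψ : ℝ → Fin N → ℝ} {x₀ : Fin N → ℝ}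
    (hφ : IsFrozenSolution φ x₀) (hψ : IsFrozenSolution ψ x₀) {t : ℝ} (ht : 0 ≤ t) :
    φ t = ψ t := by
  set f : ℝ → ℝ := fun s => ∑ i, (φ s i - ψ s i) ^ 2 with hf
  have hderiv : ∀ s, 0 ≤ s → HasDerivWithinAt f
      (∑ i, 2 * ((φ s i - ψ s i) * (drift (φ s) i - drift (ψ s) i))) (Set.Ici 0) s := by
    intro s hs
    refine HasDerivWithinAt.fun_sum fun i _ => ?_
    have h1 := hasDerivWithinAt_pi.1 (hφ.hasDeriv s hs) i
    have h2 := hasDerivWithinAt_pi.1 (hψ.hasDeriv s hs) i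
    have h3 := (h1.sub h2).pow 2
    refine (h3.congr_deriv ?_)
    simp
    ring
  have hanti : AntitoneOn f (Set.Ici 0) := by
    refine antitoneOn_of_hasDerivWithinAt_nonpos (convex_Ici 0)
      (fun s hs => (hderiv s hs).continuousWithinAt)
      (fun s hs => (hderiv s (interior_subset hs)).mono interior_subset) fun s hs => ?_
    rw [← Finset.mul_sum]
    have := sum_sub_mul_drift_sub_nonpos (hφ.mem_chamber s (interior_subset hs))
      (hψ.mem_chamber s (interior_subset hs))
    linarith
  have h0 : f 0 = 0 := by simp [hf, hφ.init, hψ.init]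
  have hle : f t ≤ 0 := h0 ▸ hanti Set.self_mem_Ici ht ht
  have heq : f t = 0 := le_antisymm hle (Finset.sum_nonneg fun i _ => sq_nonneg _)
  funext i
  have := (Finset.sum_eq_zero_iff_of_nonneg fun i _ => sq_nonneg _).1 heq i (Finset.mem_univ i)
  exact sub_eq_zero.1 (pow_eq_zero_iff two_ne_zero |>.1 this)

lemma drift_smul {N : ℕ} (r : ℝ) (x : Fin N → ℝ) : drift (r • x) = r⁻¹ • drift x := by
  funext i
  simp only [drift, Pi.smul_apply, smul_eq_mul, Finset.mul_sum]
  refine Finset.sum_congr rfl fun j _ => ?_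
  rw [← mul_sub, one_div, mul_inv, one_div]

lemma interactionMatrix_smul {N : ℕ} (r : ℝ) (x : Fin N → ℝ) :
    interactionMatrix (r • x) = (r ^ 2)⁻¹ • interactionMatrix x := by
  ext i j
  simp only [interactionMatrix, Pi.smul_apply, smul_eq_mul, Matrix.of_apply, Matrix.smul_apply,
    ← mul_sub, mul_pow, one_div, mul_inv]
  split_ifs
  · rw [mul_neg, Finset.mul_sum]
  · rfl

/-- The frozen dynamics started at a multiple of the Hermite zeros only rescales them. -/
lemma isFrozenSolution_hermiteZeros {N : ℕ} {z : Fin N → ℝ} (hz : IsOrderedHermiteZeros z)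
    {c : ℝ} (hc : 0 < c) :
    IsFrozenSolution (fun t => √(2 * t + c ^ 2) • z) (c • z) where
  init := by simp [Real.sqrt_sq hc.le]
  mem_chamber t ht := by
    have : 0 < √(2 * t + c ^ 2) := Real.sqrt_pos.2 (by positivity)
    intro i j hij
    exact mul_lt_mul_of_pos_left (hz.1 hij) this
  hasDeriv t ht := by
    have hpos : 0 < 2 * t + c ^ 2 := by positivity
    have h1 : HasDerivAt (fun s : ℝ => 2 * s + c ^ 2) 2 t := by
      simpa using ((hasDerivAt_id t).const_mul 2).add_const (c ^ 2)
    have h2 := (h1.sqrt hpos.ne').smul_const z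
    refine (h2.congr_deriv ?_).hasDerivWithinAt
    rw [drift_smul, drift_hermiteZeros hz]
    congr 1
    field_simp

/-- The time dependence is a scalar factor, so all coefficient matrices share one eigenbasis. -/
lemma interactionMatrix_frozenSolution {N : ℕ} {z : Fin N → ℝ} (hz : IsOrderedHermiteZeros z)
    {c : ℝ} (hc : 0 < c) {φ : ℝ → Fin N → ℝ} (hφ : IsFrozenSolution φ (c • z)) {t : ℝ}
    (ht : 0 ≤ t) :
    interactionMatrix (φ t) = (2 * t + c ^ 2)⁻¹ • interactionMatrix z := by
  rw [hφ.unique (isFrozenSolution_hermiteZeros hz hc) ht, interactionMatrix_smul,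
    Real.sq_sqrt (by positivity)]

/-! ### Pathwise Wiener integrals and their second moments -/

/-- A real process which almost surely has continuous paths agrees, up to a null set, with a
measurable process all of whose paths are continuous. -/
lemma exists_measurable_continuous_version {Ω : Type*} [MeasurableSpace Ω] {P : Measure Ω}
    {X : ℝ → Ω → ℝ} (hm : ∀ t, AEMeasurable (X t) P) (hc : ∀ᵐ ω ∂P, Continuous fun t => X t ω) :
    ∃ Y : ℝ → Ω → ℝ, (∀ t, Measurable (Y t)) ∧ (∀ ω, Continuous fun t => Y t ω) ∧
      ∀ᵐ ω ∂P, ∀ t, Y t ω = X t ω := by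
  -- Only countably many exceptional sets arise, one per rational time. Paths in a measurable null
  -- set containing them are replaced by zero, and measurability passes from rational to real times
  -- by continuity.
  have hae : ∀ᵐ ω ∂P, (Continuous fun t => X t ω) ∧
      ∀ q : ℚ, X (q : ℝ) ω = (hm (q : ℝ)).mk (X (q : ℝ)) ω :=
    hc.and (ae_all_iff.2 fun q => (hm q).ae_eq_mk)
  obtain ⟨S, hS, hSm, hS0⟩ := exists_measurable_superset_of_null (ae_iff.1 hae)
  have hSc : ∀ ω ∉ S, (Continuous fun t => X t ω) ∧
      ∀ q : ℚ, X (q : ℝ) ω = (hm (q : ℝ)).mk (X (q : ℝ)) ω := by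
    intro ω hω
    by_contra h
    exact hω (hS h)
  have hcont : ∀ ω, Continuous fun t => Sᶜ.indicator (X t) ω := by
    intro ω
    by_cases h : ω ∈ S
    · simp only [Set.indicator_of_notMem (Set.notMem_compl_iff.2 h)]
      exact continuous_const
    · simp only [Set.indicator_of_mem (Set.mem_compl h)]
      exact (hSc ω h).1
  refine ⟨fun t => Sᶜ.indicator (X t), fun t => ?_, hcont, ?_⟩
  · have hq : ∀ q : ℚ, Measurable (Sᶜ.indicator (X (q : ℝ))) := by
      intro q
      have : Sᶜ.indicator (X (q : ℝ)) = Sᶜ.indicator ((hm (q : ℝ)).mk (X (q : ℝ))) :=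
        Set.indicator_congr fun ω hω => (hSc ω hω).2 q
      rw [this]
      exact (hm (q : ℝ)).measurable_mk.indicator hSm.compl
    obtain ⟨u, hu, hut⟩ := mem_closure_iff_seq_limit.1 (Rat.denseRange_cast (𝕜 := ℝ) t)
    choose v hv using hu
    refine measurable_of_tendsto_metrizable (fun n => hq (v n)) (tendsto_pi_nhds.2 fun ω => ?_)
    have := ((hcont ω).tendsto t).comp hut
    refine this.congr fun n => ?_
    simp [← hv n]
  · have : ∀ᵐ ω ∂P, ω ∉ S := measure_eq_zero_iff_ae_notMem.1 hS0
    filter_upwards [this] with ω hω t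
    exact Set.indicator_of_mem (Set.mem_compl hω) _

/-- A measurable centred process with continuous paths and the second moments of a multiple of
Brownian motion. -/
structure HasBrownianMoments {Ω : Type*} [MeasurableSpace Ω] (X : ℝ → Ω → ℝ) (P : Measure Ω) :
    Prop where
  measurable : ∀ t, Measurable (X t)
  continuous : ∀ ω, Continuous fun t => X t ω
  memLp : ∀ t, MemLp (X t) 2 P
  integral_eq_zero : ∀ t, ∫ ω, X t ω ∂P = 0
  integral_sq : ∃ κ : ℝ, ∀ t, 0 ≤ t → ∫ ω, X t ω ^ 2 ∂P = κ * t

namespace HasBrownianMoments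

variable {Ω : Type*} [MeasurableSpace Ω] {P : Measure Ω} {X Y : ℝ → Ω → ℝ} {t : ℝ}
  {g g' h h' : ℝ → ℝ} {κ : ℝ}

lemma measurable_uncurry (hX : HasBrownianMoments X P) : Measurable (Function.uncurry X) := by
  have := measurable_uncurry_of_continuous_of_measurable (u := fun t ω => X t ω)
    hX.continuous hX.measurable
  exact this

variable [IsProbabilityMeasure P]

/-- Tonelli reduces this to integrability of `g s ^ 2 * (κ * s)`; square integrability on the
product is what justifies Fubini below. -/
lemma memLp_prod (hX : HasBrownianMoments X P) (hg : ContinuousOn g (Set.Icc 0 t)) :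
    MemLp (fun p : ℝ × Ω => g p.1 * X p.1 p.2) 2 ((volume.restrict (Set.Ioc 0 t)).prod P) := by
  have hg' : AEStronglyMeasurable g (volume.restrict (Set.Ioc 0 t)) :=
    (hg.mono Set.Ioc_subset_Icc_self).aestronglyMeasurable measurableSet_Ioc
  have hm : AEStronglyMeasurable (fun p : ℝ × Ω => g p.1 * X p.1 p.2)
      ((volume.restrict (Set.Ioc 0 t)).prod P) :=
    hg'.comp_fst.mul hX.measurable_uncurry.aestronglyMeasurable
  obtain ⟨κ, hκ⟩ := hX.integral_sq
  rw [memLp_two_iff_integrable_sq hm, integrable_prod_iff (by exact hm.pow 2)]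
  constructor
  · refine Filter.Eventually.of_forall fun s => ?_
    simp only [mul_pow]
    exact (hX.memLp s).integrable_sq.const_mul _
  · have hint : IntegrableOn (fun s => g s ^ 2 * (κ * s)) (Set.Ioc 0 t) :=
      (((hg.pow 2).mul (by fun_prop)).integrableOn_Icc).mono_set Set.Ioc_subset_Icc_self
    refine hint.congr ?_
    filter_upwards [ae_restrict_mem measurableSet_Ioc] with s hs
    have e : ∀ ω, ‖(g s * X s ω) ^ 2‖ = g s ^ 2 * X s ω ^ 2 := fun ω => by
      rw [Real.norm_of_nonneg (sq_nonneg _), mul_pow]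
    simp only [e, integral_const_mul]
    rw [hκ s hs.1.le]

lemma integral_mul_intervalIntegral (hX : HasBrownianMoments X P) (ht : 0 ≤ t)
    (hg : ContinuousOn g (Set.Icc 0 t)) {Z : Ω → ℝ} (hZ : MemLp Z 2 P) :
    ∫ ω, Z ω * (∫ s in (0 : ℝ)..t, g s * X s ω) ∂P
      = ∫ s in (0 : ℝ)..t, g s * ∫ ω, Z ω * X s ω ∂P := by
  have hint : Integrable (fun p : ℝ × Ω => Z p.2 * (g p.1 * X p.1 p.2))
      ((volume.restrict (Set.Ioc 0 t)).prod P) :=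
    (hZ.comp_snd _).integrable_mul (hX.memLp_prod hg)
  simp only [intervalIntegral.integral_of_le ht, ← integral_const_mul]
  rw [← integral_integral_swap (f := fun s ω => Z ω * (g s * X s ω)) hint]
  refine integral_congr_ae (Filter.Eventually.of_forall fun s => ?_)
  refine integral_congr_ae (Filter.Eventually.of_forall fun ω => ?_)
  simp only
  ring

end HasBrownianMoments

/-- The Cauchy-Schwarz inequality against the constant function. -/
lemma sq_intervalIntegral_le {f : ℝ → ℝ} {t : ℝ} (ht : 0 ≤ t) (hf : ContinuousOn f (Set.Icc 0 t)) :
    (∫ s in (0 : ℝ)..t, f s) ^ 2 ≤ t * ∫ s in (0 : ℝ)..t, f s ^ 2 := by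
  rcases ht.eq_or_lt with rfl | ht'
  · simp
  have hf' : ContinuousOn f (Set.uIcc 0 t) := by rwa [Set.uIcc_of_le ht]
  -- `m` is the mean of `f`; the inequality is `∫ (f - m)² ≥ 0` expanded.
  set m := (∫ s in (0 : ℝ)..t, f s) / t with hm
  have h0 : 0 ≤ ∫ s in (0 : ℝ)..t, (f s - m) ^ 2 :=
    intervalIntegral.integral_nonneg ht fun s _ => sq_nonneg _
  have h1 : ∫ s in (0 : ℝ)..t, (f s - m) ^ 2
      = (∫ s in (0 : ℝ)..t, f s ^ 2) - 2 * m * (∫ s in (0 : ℝ)..t, f s) + m ^ 2 * t := by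
    have : ∀ s, (f s - m) ^ 2 = f s ^ 2 - 2 * m * f s + m ^ 2 := fun s => by ring
    simp only [this]
    rw [intervalIntegral.integral_add, intervalIntegral.integral_sub,
      intervalIntegral.integral_const_mul]
    · simp [mul_comm]
    · exact (hf'.pow 2).intervalIntegrable
    · exact (hf'.intervalIntegrable).const_mul _
    · exact ((hf'.pow 2).intervalIntegrable).sub ((hf'.intervalIntegrable).const_mul _)
    · exact intervalIntegrable_const
  have h2 : (∫ s in (0 : ℝ)..t, f s) = m * t := by rw [hm]; field_simp
  rw [h1, h2] at h0
  rw [h2]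
  nlinarith

/-- The Wiener integral `∫ g dX` over `[0, t]`, defined pathwise by partial integration. -/
def wienerIntegral {Ω : Type*} (g g' : ℝ → ℝ) (X : ℝ → Ω → ℝ) (t : ℝ) (ω : Ω) : ℝ :=
  g t * X t ω - ∫ s in (0 : ℝ)..t, g' s * X s ω

namespace HasBrownianMoments

variable {Ω : Type*} [MeasurableSpace Ω] {P : Measure Ω} [IsProbabilityMeasure P]
  {X Y : ℝ → Ω → ℝ} {t : ℝ} {g g' h h' : ℝ → ℝ} {κ : ℝ}

lemma memLp_intervalIntegral (hX : HasBrownianMoments X P) (ht : 0 ≤ t)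
    (hg : ContinuousOn g (Set.Icc 0 t)) :
    MemLp (fun ω => ∫ s in (0 : ℝ)..t, g s * X s ω) 2 P := by
  have hL := hX.memLp_prod hg
  have hm : AEStronglyMeasurable (fun ω => ∫ s in (0 : ℝ)..t, g s * X s ω) P := by
    simp only [intervalIntegral.integral_of_le ht]
    exact hL.aestronglyMeasurable.prod_swap.integral_prod_right'
  rw [memLp_two_iff_integrable_sq hm]
  have hint := (hL.integrable_sq.integral_prod_right).const_mul t
  refine hint.mono' (hm.pow 2) (Filter.Eventually.of_forall fun ω => ?_)
  rw [Real.norm_of_nonneg (sq_nonneg _)]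
  have := sq_intervalIntegral_le ht (hg.fun_mul (hX.continuous ω).continuousOn)
  simpa only [intervalIntegral.integral_of_le ht] using this

lemma memLp_wienerIntegral (hX : HasBrownianMoments X P) (ht : 0 ≤ t)
    (hg : ContinuousOn g' (Set.Icc 0 t)) : MemLp (wienerIntegral g g' X t) 2 P :=
  ((hX.memLp t).const_mul (g t)).sub (hX.memLp_intervalIntegral ht hg)

lemma integral_mul_wienerIntegral (hX : HasBrownianMoments X P) (ht : 0 ≤ t)
    (hg : ContinuousOn g' (Set.Icc 0 t)) {Z : Ω → ℝ} (hZ : MemLp Z 2 P) :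
    ∫ ω, Z ω * wienerIntegral g g' X t ω ∂P
      = g t * (∫ ω, Z ω * X t ω ∂P) - ∫ s in (0 : ℝ)..t, g' s * ∫ ω, Z ω * X s ω ∂P := by
  rw [← hX.integral_mul_intervalIntegral ht hg hZ, ← integral_const_mul, ← integral_sub]
  · refine integral_congr_ae (Filter.Eventually.of_forall fun ω => ?_)
    simp only [wienerIntegral]
    ring
  · exact (hZ.integrable_mul (hX.memLp t)).const_mul _
  · exact hZ.integrable_mul (hX.memLp_intervalIntegral ht hg)

lemma integral_wienerIntegral (hX : HasBrownianMoments X P) (ht : 0 ≤ t)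
    (hg : ContinuousOn g' (Set.Icc 0 t)) : ∫ ω, wienerIntegral g g' X t ω ∂P = 0 := by
  have := hX.integral_mul_wienerIntegral (g := g) ht hg (memLp_const 1)
  simpa [hX.integral_eq_zero] using this

/-- The kernel `min s r` is linear in `r` up to `s` and constant afterwards. Splitting at `s` and
integrating by parts on `[0, s]` cancels the boundary terms. -/
lemma integral_eval_mul_wienerIntegral (hX : HasBrownianMoments X P)
    (hY : HasBrownianMoments Y P)
    (hXY : ∀ s r, 0 ≤ s → 0 ≤ r → ∫ ω, X s ω * Y r ω ∂P = κ * min s r)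
    (hg : ∀ s ∈ Set.Icc 0 t, HasDerivAt g (g' s) s) (hg' : ContinuousOn g' (Set.Icc 0 t))
    {s : ℝ} (hs : s ∈ Set.Icc 0 t) :
    ∫ ω, X s ω * wienerIntegral g g' Y t ω ∂P = κ * ∫ r in (0 : ℝ)..s, g r := by
  have ht : 0 ≤ t := hs.1.trans hs.2
  have hsub1 : Set.uIcc 0 s ⊆ Set.Icc 0 t := by
    rw [Set.uIcc_of_le hs.1]
    exact Set.Icc_subset_Icc_right hs.2
  have hsub2 : Set.uIcc s t ⊆ Set.Icc 0 t := by
    rw [Set.uIcc_of_le hs.2]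
    exact Set.Icc_subset_Icc_left hs.1
  have hi1 : IntervalIntegrable g' volume 0 s := (hg'.mono hsub1).intervalIntegrable
  have hi2 : IntervalIntegrable g' volume s t := (hg'.mono hsub2).intervalIntegrable
  rw [hY.integral_mul_wienerIntegral ht hg' (hX.memLp s), hXY s t hs.1 ht, min_eq_left hs.2]
  have hcont : ContinuousOn (fun r => g' r * (κ * min s r)) (Set.Icc 0 t) :=
    hg'.mul (by fun_prop)
  have e0 : ∫ r in (0 : ℝ)..t, g' r * ∫ ω, X s ω * Y r ω ∂P
      = ∫ r in (0 : ℝ)..t, g' r * (κ * min s r) := by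
    refine intervalIntegral.integral_congr fun r hr => ?_
    rw [Set.uIcc_of_le ht] at hr
    simp only [hXY s r hs.1 hr.1]
  have e1 : ∫ r in (0 : ℝ)..s, g' r * (κ * min s r) = κ * ∫ r in (0 : ℝ)..s, r * g' r := by
    rw [← intervalIntegral.integral_const_mul]
    refine intervalIntegral.integral_congr fun r hr => ?_
    rw [Set.uIcc_of_le hs.1] at hr
    simp only [min_eq_right hr.2]
    ring
  have e2 : ∫ r in s..t, g' r * (κ * min s r) = κ * s * ∫ r in s..t, g' r := by
    rw [← intervalIntegral.integral_const_mul]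
    refine intervalIntegral.integral_congr fun r hr => ?_
    rw [Set.uIcc_of_le hs.2] at hr
    simp only [min_eq_left hr.1]
    ring
  have e3 : ∫ r in s..t, g' r = g t - g s :=
    intervalIntegral.integral_eq_sub_of_hasDerivAt (fun r hr => hg r (hsub2 hr)) hi2
  have e4 : ∫ r in (0 : ℝ)..s, r * g' r = s * g s - 0 * g 0 - ∫ r in (0 : ℝ)..s, 1 * g r :=
    intervalIntegral.integral_mul_deriv_eq_deriv_mul (fun r _ => hasDerivAt_id r)
      (fun r hr => hg r (hsub1 hr)) intervalIntegrable_const hi1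
  rw [e0, ← intervalIntegral.integral_add_adjacent_intervals (b := s)
    (hcont.mono hsub1).intervalIntegrable (hcont.mono hsub2).intervalIntegrable, e1, e2, e3, e4]
  simp only [one_mul]
  ring

/-- The Itô isometry for Wiener integrals. -/
lemma integral_wienerIntegral_mul_wienerIntegral (hX : HasBrownianMoments X P)
    (hY : HasBrownianMoments Y P)
    (hXY : ∀ s r, 0 ≤ s → 0 ≤ r → ∫ ω, X s ω * Y r ω ∂P = κ * min s r) (ht : 0 ≤ t)
    (hg : ∀ s ∈ Set.Icc 0 t, HasDerivAt g (g' s) s) (hg' : ContinuousOn g' (Set.Icc 0 t))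
    (hh : ∀ s ∈ Set.Icc 0 t, HasDerivAt h (h' s) s) (hh' : ContinuousOn h' (Set.Icc 0 t)) :
    ∫ ω, wienerIntegral g g' X t ω * wienerIntegral h h' Y t ω ∂P
      = κ * ∫ s in (0 : ℝ)..t, g s * h s := by
  have hch : ContinuousOn h (Set.Icc 0 t) := fun s hs => (hh s hs).continuousAt.continuousWithinAt
  simp_rw [mul_comm (wienerIntegral g g' X t _)]
  rw [hX.integral_mul_wienerIntegral ht hg' (hY.memLp_wienerIntegral ht hh')]
  have e0 : ∀ s ∈ Set.Icc 0 t, ∫ ω, wienerIntegral h h' Y t ω * X s ω ∂P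
      = κ * ∫ r in (0 : ℝ)..s, h r := by
    intro s hs
    simp_rw [mul_comm (wienerIntegral h h' Y t _)]
    exact hX.integral_eval_mul_wienerIntegral hY hXY hh hh' hs
  have e1 : ∫ s in (0 : ℝ)..t, g' s * ∫ ω, wienerIntegral h h' Y t ω * X s ω ∂P
      = κ * ∫ s in (0 : ℝ)..t, (∫ r in (0 : ℝ)..s, h r) * g' s := by
    rw [← intervalIntegral.integral_const_mul]
    refine intervalIntegral.integral_congr fun s hs => ?_
    rw [Set.uIcc_of_le ht] at hs
    simp only [e0 s hs]
    ring
  -- A second integration by parts, now against the primitive of `h`; its boundary term at `t`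
  -- cancels the one in the definition of the Wiener integral.
  have e2 : ∫ s in (0 : ℝ)..t, (∫ r in (0 : ℝ)..s, h r) * g' s
      = (∫ r in (0 : ℝ)..t, h r) * g t - (∫ r in (0 : ℝ)..0, h r) * g 0
        - ∫ s in (0 : ℝ)..t, h s * g s := by
    have hut : Set.uIcc 0 t = Set.Icc 0 t := Set.uIcc_of_le ht
    have hhi : IntervalIntegrable h volume 0 t := by
      rw [← hut] at hch
      exact hch.intervalIntegrable
    refine intervalIntegral.integral_mul_deriv_eq_deriv_mul_of_hasDerivWithinAt ?_ ?_ hhi ?_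
    · intro s hs
      rw [hut] at hs ⊢
      have : Fact (s ∈ Set.Icc 0 t) := ⟨hs⟩
      exact intervalIntegral.integral_hasDerivWithinAt_right
        (hhi.mono_set (by
          rw [hut, Set.uIcc_of_le hs.1]; exact Set.Icc_subset_Icc_right hs.2))
        (hch.stronglyMeasurableAtFilter_nhdsWithin measurableSet_Icc s) (hch s hs)
    · intro s hs
      exact (hg s (hut ▸ hs)).hasDerivWithinAt
    · rw [← hut] at hg'
      exact hg'.intervalIntegrable
  rw [e0 t ⟨ht, le_rfl⟩, e1, e2]
  simp only [intervalIntegral.integral_same, mul_comm (h _)]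
  ring

end HasBrownianMoments

/-! ### Linear combinations of the Brownian components -/

section BrownianVec

variable {Ω : Type*} [MeasurableSpace Ω] {P : Measure Ω} {N : ℕ} {B : Fin N → ℝ≥0 → Ω → ℝ}

lemma IsBrownianVec.memLp (hB : IsBrownianVec B P) (i : Fin N) (s : ℝ≥0) : MemLp (B i s) 2 P :=
  ((hB.brownian i).hasLaw_eval s).hasGaussianLaw.memLp_two

lemma IsBrownianVec.integral_mul [IsProbabilityMeasure P] (hB : IsBrownianVec B P) (i j : Fin N)
    (s r : ℝ≥0) :
    ∫ ω, B i s ω * B j r ω ∂P = if i = j then ((min s r : ℝ≥0) : ℝ) else 0 := by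
  have hcov : ∫ ω, B i s ω * B j r ω ∂P = cov[B i s, B j r; P] := by
    rw [covariance_eq_sub (hB.memLp i s) (hB.memLp j r), (hB.brownian i).integral_eval, zero_mul,
      sub_zero]
    rfl
  rw [hcov]
  split_ifs with h
  · subst h
    exact (hB.brownian i).covariance_eval s r
  · have hind : IndepFun (B i s) (B j r) P :=
      (hB.indep.indepFun h).comp (measurable_pi_apply s) (measurable_pi_apply r)
    exact hind.covariance_eq_zero (hB.memLp i s) (hB.memLp j r)

lemma IsBrownianVec.exists_version (hB : IsBrownianVec B P) :
    ∃ Y : Fin N → ℝ → Ω → ℝ, (∀ i t, Measurable (Y i t)) ∧ (∀ i ω, Continuous fun t => Y i t ω) ∧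
      ∀ᵐ ω ∂P, ∀ i t, Y i t ω = B i t.toNNReal ω := by
  have h : ∀ i, ∃ Y : ℝ → Ω → ℝ, (∀ t, Measurable (Y t)) ∧ (∀ ω, Continuous fun t => Y t ω) ∧
      ∀ᵐ ω ∂P, ∀ t, Y t ω = B i t.toNNReal ω := fun i =>
    exists_measurable_continuous_version (X := fun t => B i t.toNNReal)
      (fun t => (hB.brownian i).aemeasurable _)
      ((hB.brownian i).cont.mono fun ω hω => hω.comp continuous_real_toNNReal)
  choose Y hm hc hae using h
  exact ⟨Y, hm, hc, ae_all_iff.2 hae⟩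

variable [IsProbabilityMeasure P] {Y : Fin N → ℝ → Ω → ℝ}

/-- For orthonormal directions the factor `u ⬝ᵥ v` is `0` or `1`, which decorrelates the
eigencomponents. -/
lemma IsBrownianVec.integral_sum_mul_sum (hB : IsBrownianVec B P)
    (hY : ∀ᵐ ω ∂P, ∀ i t, Y i t ω = B i t.toNNReal ω) (u v : Fin N → ℝ) {s r : ℝ} (hs : 0 ≤ s)
    (hr : 0 ≤ r) :
    ∫ ω, (∑ i, u i * Y i s ω) * (∑ j, v j * Y j r ω) ∂P = (u ⬝ᵥ v) * min s r := by
  have h1 : (fun ω => (∑ i, u i * Y i s ω) * (∑ j, v j * Y j r ω)) =ᵐ[P]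
      fun ω => ∑ i, ∑ j, (u i * v j) * (B i s.toNNReal ω * B j r.toNNReal ω) := by
    filter_upwards [hY] with ω hω
    rw [Finset.sum_mul_sum]
    refine Finset.sum_congr rfl fun i _ => Finset.sum_congr rfl fun j _ => ?_
    rw [hω, hω]
    ring
  have hint : ∀ i j, Integrable
      (fun ω => (u i * v j) * (B i s.toNNReal ω * B j r.toNNReal ω)) P := fun i j =>
    ((hB.memLp i _).integrable_mul (hB.memLp j _)).const_mul _
  rw [integral_congr_ae h1, integral_finsetSum _ fun i _ => integrable_finsetSum _ fun j _ => hint i j,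
    dotProduct, Finset.sum_mul]
  refine Finset.sum_congr rfl fun i _ => ?_
  rw [integral_finsetSum _ fun j _ => hint i j]
  simp only [integral_const_mul, hB.integral_mul, mul_ite, mul_zero, Finset.sum_ite_eq,
    Finset.mem_univ, if_true]
  rw [NNReal.coe_min, Real.coe_toNNReal _ hs, Real.coe_toNNReal _ hr]

lemma IsBrownianVec.hasBrownianMoments_sum (hB : IsBrownianVec B P)
    (hm : ∀ i t, Measurable (Y i t)) (hc : ∀ i ω, Continuous fun t => Y i t ω)
    (hY : ∀ᵐ ω ∂P, ∀ i t, Y i t ω = B i t.toNNReal ω) (u : Fin N → ℝ) :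
    HasBrownianMoments (fun t ω => ∑ i, u i * Y i t ω) P where
  measurable t := Finset.measurable_fun_sum _ fun i _ => (hm i t).const_mul _
  continuous ω := continuous_finsetSum _ fun i _ => (hc i ω).const_mul _
  memLp t := memLp_finsetSum _ fun i _ => MemLp.const_mul
    ((memLp_congr_ae (hY.mono fun ω hω => hω i t)).2 (hB.memLp i _)) _
  integral_eq_zero t := by
    have h1 : (fun ω => ∑ i, u i * Y i t ω) =ᵐ[P] fun ω => ∑ i, u i * B i t.toNNReal ω := by
      filter_upwards [hY] with ω hω
      simp only [hω]
    rw [integral_congr_ae h1, integral_finsetSum _ fun i _ =>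
      ((hB.memLp i _).integrable one_le_two).const_mul _]
    refine Finset.sum_eq_zero fun i _ => ?_
    rw [integral_const_mul, (hB.brownian i).integral_eval, mul_zero]
  integral_sq := ⟨u ⬝ᵥ u, fun t ht => by
    simp only [pow_two]
    rw [hB.integral_sum_mul_sum hY u u ht ht, min_self]⟩

end BrownianVec

/-! ### The scalar linear equation and its variance -/

/-- The integrating factor of the scalar equation with coefficient `μ / (2 s + c ^ 2)`. -/
def integratingFactor (μ c s : ℝ) : ℝ := (2 * s + c ^ 2) ^ (-μ / 2)

/-- The derivative of `integratingFactor`. -/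
def integratingFactorDeriv (μ c s : ℝ) : ℝ := -μ * (2 * s + c ^ 2)⁻¹ * integratingFactor μ c s

section Scalar

variable {μ c s t : ℝ}

lemma integratingFactor_pos (hc : 0 < c) (hs : 0 ≤ s) : 0 < integratingFactor μ c s :=
  Real.rpow_pos_of_pos (by positivity) _

lemma hasDerivAt_integratingFactor (hc : 0 < c) (hs : 0 ≤ s) :
    HasDerivAt (integratingFactor μ c) (integratingFactorDeriv μ c s) s := by
  have hpos : 0 < 2 * s + c ^ 2 := by positivity
  have h1 : HasDerivAt (fun s : ℝ => 2 * s + c ^ 2) 2 s := by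
    simpa using ((hasDerivAt_id s).const_mul 2).add_const (c ^ 2)
  refine (h1.rpow_const (p := -μ / 2) (Or.inl hpos.ne')).congr_deriv ?_
  rw [Real.rpow_sub_one hpos.ne', integratingFactorDeriv, integratingFactor]
  ring

lemma continuousOn_inv_time (hc : 0 < c) :
    ContinuousOn (fun s : ℝ => (2 * s + c ^ 2)⁻¹) (Set.Ici 0) :=
  ContinuousOn.inv₀ (by fun_prop) fun s hs => by
    have : 0 ≤ s := hs
    positivity

lemma continuousOn_integratingFactorDeriv (hc : 0 < c) :
    ContinuousOn (integratingFactorDeriv μ c) (Set.Icc 0 t) := by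
  refine (continuousOn_const.mul ((continuousOn_inv_time hc).mono Set.Icc_subset_Ici_self)).mul ?_
  exact fun s hs => (hasDerivAt_integratingFactor hc hs.1).continuousAt.continuousWithinAt

/-- Variation of constants for a linear scalar equation with additive continuous noise. -/
lemma integratingFactor_mul_eq (hc : 0 < c) {w β : ℝ → ℝ} (hw : Continuous w) (hβ : Continuous β)
    (h : ∀ s, 0 ≤ s → w s = β s + ∫ r in (0 : ℝ)..s, μ * (2 * r + c ^ 2)⁻¹ * w r) (ht : 0 ≤ t) :
    integratingFactor μ c t * w t = integratingFactor μ c t * β t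
      - ∫ s in (0 : ℝ)..t, integratingFactorDeriv μ c s * β s := by
  set k : ℝ → ℝ := fun r => μ * (2 * r + c ^ 2)⁻¹ * w r with hk
  set V : ℝ → ℝ := fun s => ∫ r in (0 : ℝ)..s, k r with hV
  have hut : Set.uIcc 0 t = Set.Icc 0 t := Set.uIcc_of_le ht
  have hkc : ContinuousOn k (Set.Icc 0 t) :=
    (continuousOn_const.mul ((continuousOn_inv_time hc).mono Set.Icc_subset_Ici_self)).mul
      hw.continuousOn
  have hki : IntervalIntegrable k volume 0 t := by
    rw [← hut] at hkc
    exact hkc.intervalIntegrable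
  have hVd : ∀ s ∈ Set.Icc 0 t, HasDerivWithinAt V (k s) (Set.Icc 0 t) s := by
    intro s hs
    have : Fact (s ∈ Set.Icc 0 t) := ⟨hs⟩
    exact intervalIntegral.integral_hasDerivWithinAt_right
      (hki.mono_set (by
        rw [hut, Set.uIcc_of_le hs.1]; exact Set.Icc_subset_Icc_right hs.2))
      (hkc.stronglyMeasurableAtFilter_nhdsWithin measurableSet_Icc s) (hkc s hs)
  -- The noise `β` need not be differentiable, so the product rule is applied to `g V` with `V = w -
  -- β`; since `g' = -μ (2s + c²)⁻¹ g`, the terms in `V` cancel.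
  have hprod : ∀ s ∈ Set.Icc 0 t, HasDerivWithinAt (fun s => integratingFactor μ c s * V s)
      (-(integratingFactorDeriv μ c s * β s)) (Set.Icc 0 t) s := by
    intro s hs
    refine ((hasDerivAt_integratingFactor hc hs.1).hasDerivWithinAt.mul (hVd s hs)).congr_deriv ?_
    have hws : w s = β s + V s := h s hs.1
    simp only [hk, integratingFactorDeriv, hws]
    ring
  have hint : ∫ s in (0 : ℝ)..t, -(integratingFactorDeriv μ c s * β s)
      = integratingFactor μ c t * V t - integratingFactor μ c 0 * V 0 := by
    refine intervalIntegral.integral_eq_sub_of_hasDerivAt_of_le ht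
      (fun s hs => (hprod s hs).continuousWithinAt)
      (fun s hs => (hprod s (Set.Ioo_subset_Icc_self hs)).hasDerivAt (Icc_mem_nhds hs.1 hs.2)) ?_
    have : ContinuousOn (fun s => -(integratingFactorDeriv μ c s * β s)) (Set.uIcc 0 t) := by
      rw [hut]
      exact ((continuousOn_integratingFactorDeriv hc).mul hβ.continuousOn).neg
    exact this.intervalIntegrable
  have hV0 : V 0 = 0 := by simp [hV]
  rw [intervalIntegral.integral_neg, hV0] at hint
  have hwt : w t = β t + V t := h t ht
  rw [hwt]
  linear_combination -hint

/-- The variance of the component along an eigenvector of eigenvalue `μ`. -/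
lemma inv_sq_mul_integral_integratingFactor_sq (hc : 0 < c) (ht : 0 ≤ t) (hμ : μ < 1) :
    ((integratingFactor μ c t) ^ 2)⁻¹
        * ∫ s in (0 : ℝ)..t, integratingFactor μ c s * integratingFactor μ c s
      = (t + c ^ 2 / 2) * ((1 - μ)⁻¹ *
        (1 - Real.exp (Real.log (c ^ 2 / (2 * t + c ^ 2)) * (1 - μ)))) := by
  have hμ' : 1 - μ ≠ 0 := by linarith
  have hpos : ∀ s : ℝ, 0 ≤ s → 0 < 2 * s + c ^ 2 := fun s hs => by positivity
  have hsq : ∀ s : ℝ, 0 ≤ s →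
      integratingFactor μ c s * integratingFactor μ c s = (2 * s + c ^ 2) ^ (-μ) := by
    intro s hs
    rw [integratingFactor, ← Real.rpow_add (hpos s hs)]
    congr 1
    ring
  -- The squared factor is `(2s + c²)^(-μ)`; its primitive is again a power, because `μ ≠ 1`.
  have hd : ∀ s ∈ Set.uIcc 0 t, HasDerivAt
      (fun s : ℝ => (2 * (1 - μ))⁻¹ * (2 * s + c ^ 2) ^ (1 - μ))
      (integratingFactor μ c s * integratingFactor μ c s) s := by
    intro s hs
    rw [Set.uIcc_of_le ht] at hs
    have h1 : HasDerivAt (fun s : ℝ => 2 * s + c ^ 2) 2 s := by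
      simpa using ((hasDerivAt_id s).const_mul 2).add_const (c ^ 2)
    refine ((h1.rpow_const (p := 1 - μ) (Or.inl (hpos s hs.1).ne')).const_mul _).congr_deriv ?_
    rw [hsq s hs.1, show 1 - μ - 1 = -μ by ring]
    field_simp
  have hcont : ContinuousOn (fun s => integratingFactor μ c s * integratingFactor μ c s)
      (Set.uIcc 0 t) := by
    rw [Set.uIcc_of_le ht]
    have : ContinuousOn (integratingFactor μ c) (Set.Icc 0 t) := fun s hs =>
      (hasDerivAt_integratingFactor hc hs.1).continuousAt.continuousWithinAt
    exact this.mul this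
  rw [intervalIntegral.integral_eq_sub_of_hasDerivAt hd hcont.intervalIntegrable, pow_two,
    hsq t ht]
  have hT := hpos t ht
  have hratio : 0 < c ^ 2 / (2 * t + c ^ 2) := by positivity
  rw [← Real.rpow_def_of_pos hratio, Real.div_rpow (by positivity) hT.le, mul_zero, zero_add,
    ← Real.rpow_neg hT.le, neg_neg]
  have h1 : (2 * t + c ^ 2) ^ μ = (2 * t + c ^ 2) / (2 * t + c ^ 2) ^ (1 - μ) := by
    rw [Real.rpow_sub hT, Real.rpow_one]
    field_simp
  have h2 := Real.rpow_pos_of_pos hT (1 - μ)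
  rw [h1]
  field_simp

/-- The index is shifted by one: the eigenvalue `μ = -k` of the interaction matrix gives `j = 1 - μ
= k + 1`. -/
lemma covEigenvalue_succ (hc : 0 < c) (ht : 0 ≤ t) (k : ℕ) :
    covEigenvalue (k + 1) t c = (t + c ^ 2 / 2) * ((1 - -(k : ℝ))⁻¹ *
      (1 - Real.exp (Real.log (c ^ 2 / (2 * t + c ^ 2)) * (1 - -(k : ℝ))))) := by
  have hT : 0 < 2 * t + c ^ 2 := by positivity
  have hratio : 0 < c ^ 2 / (2 * t + c ^ 2) := by positivity
  have hk : (1 - -(k : ℝ)) = ((k + 1 : ℕ) : ℝ) := by push_cast; ring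
  have hk0 : ((k + 1 : ℕ) : ℝ) ≠ 0 := by positivity
  rw [← Real.rpow_def_of_pos hratio, hk, Real.rpow_natCast, covEigenvalue, Nat.add_sub_cancel,
    div_pow, pow_mul, pow_succ (2 * t + c ^ 2)]
  field_simp

end Scalar

/-! ### Functional calculus for orthogonally diagonalised matrices -/

section Matrices

variable {n : Type*} [Fintype n] [DecidableEq n] {U : Matrix n n ℝ}

lemma isUnit_of_transpose_mul_self (hU : Uᵀ * U = 1) : IsUnit U :=
  (Matrix.isUnit_iff_isUnit_det U).2
    (Matrix.isUnit_det_of_left_inverse hU)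

lemma inv_eq_transpose_of_transpose_mul_self (hU : Uᵀ * U = 1) : U⁻¹ = Uᵀ :=
  Matrix.inv_eq_left_inv hU

lemma conj_diagonal_mul (hU : Uᵀ * U = 1) (d e : n → ℝ) :
    (U * Matrix.diagonal d * Uᵀ) * (U * Matrix.diagonal e * Uᵀ)
      = U * Matrix.diagonal (fun i => d i * e i) * Uᵀ := by
  rw [← Matrix.diagonal_mul_diagonal]
  calc (U * Matrix.diagonal d * Uᵀ) * (U * Matrix.diagonal e * Uᵀ)
      = U * Matrix.diagonal d * (Uᵀ * U) * Matrix.diagonal e * Uᵀ := by simp only [mul_assoc]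
    _ = _ := by rw [hU]; simp only [mul_assoc, one_mul]

lemma conj_diagonal_const (hU : Uᵀ * U = 1) (a : ℝ) :
    U * Matrix.diagonal (fun _ => a) * Uᵀ = a • (1 : Matrix n n ℝ) := by
  have h : U * Uᵀ = 1 := mul_eq_one_comm.1 hU
  rw [show Matrix.diagonal (fun _ : n => a) = a • (1 : Matrix n n ℝ) by
    rw [← Matrix.diagonal_one, ← Matrix.diagonal_smul]; congr 1; funext; simp]
  simp [h]

lemma one_sub_conj_diagonal (hU : Uᵀ * U = 1) (d : n → ℝ) :
    1 - U * Matrix.diagonal d * Uᵀ = U * Matrix.diagonal (fun i => 1 - d i) * Uᵀ := by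
  have h := conj_diagonal_const hU 1
  rw [one_smul] at h
  nth_rw 1 [← h]
  rw [← sub_mul, ← mul_sub, Matrix.diagonal_sub]

lemma smul_conj_diagonal (a : ℝ) (d : n → ℝ) :
    a • (U * Matrix.diagonal d * Uᵀ) = U * Matrix.diagonal (fun i => a * d i) * Uᵀ := by
  rw [show (fun i => a * d i) = a • d from rfl, Matrix.diagonal_smul]
  simp

lemma exp_conj_diagonal (hU : Uᵀ * U = 1) (d : n → ℝ) :
    NormedSpace.exp (U * Matrix.diagonal d * Uᵀ)
      = U * Matrix.diagonal (fun i => Real.exp (d i)) * Uᵀ := by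
  rw [← inv_eq_transpose_of_transpose_mul_self hU,
    Matrix.exp_conj _ _ (isUnit_of_transpose_mul_self hU), Matrix.exp_diagonal]
  congr 3
  funext i
  rw [Pi.coe_exp, Real.exp_eq_exp_ℝ]

lemma conj_diagonal_mul_inv (hU : Uᵀ * U = 1) {d : n → ℝ} (hd : ∀ i, d i ≠ 0) :
    (U * Matrix.diagonal d * Uᵀ) * (U * Matrix.diagonal (fun i => (d i)⁻¹) * Uᵀ) = 1 := by
  rw [conj_diagonal_mul hU]
  simp only [mul_inv_cancel₀ (hd _)]
  rw [conj_diagonal_const hU, one_smul]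

lemma roots_charpoly_conj_diagonal (hU : Uᵀ * U = 1) (d : n → ℝ) :
    (U * Matrix.diagonal d * Uᵀ).charpoly.roots = Finset.univ.val.map d := by
  rw [Matrix.charpoly_mul_comm, ← mul_assoc, hU, one_mul, Matrix.charpoly_diagonal,
    Polynomial.roots_prod _ _ (Finset.prod_ne_zero_iff.2 fun k _ => Polynomial.X_sub_C_ne_zero _)]
  simp only [Polynomial.roots_X_sub_C, Multiset.bind_singleton]

lemma _root_.Matrix.IsHermitian.exists_eq_conj_diagonal {A : Matrix n n ℝ} (hA : A.IsHermitian) :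
    ∃ U : Matrix n n ℝ, Uᵀ * U = 1 ∧ A = U * Matrix.diagonal hA.eigenvalues * Uᵀ := by
  refine ⟨hA.eigenvectorUnitary, ?_, ?_⟩
  · have := Unitary.coe_star_mul_self hA.eigenvectorUnitary
    rwa [Matrix.star_eq_conjTranspose, Matrix.conjTranspose_eq_transpose_of_trivial] at this
  · have h := hA.spectral_theorem
    rw [Unitary.conjStarAlgAut_apply, Matrix.star_eq_conjTranspose,
      Matrix.conjTranspose_eq_transpose_of_trivial] at h
    exact h

end Matrices

lemma map_val_Icc_one {α : Type*} (N : ℕ) (f : ℕ → α) :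
    (Finset.Icc 1 N).val.map f = Finset.univ.val.map fun k : Fin N => f (k + 1) := by
  have hinj : Function.Injective fun k : Fin N => (k : ℕ) + 1 := fun a b h =>
    Fin.ext (Nat.succ_injective h)
  have h1 : Finset.Icc 1 N = (Finset.univ : Finset (Fin N)).map ⟨_, hinj⟩ := by
    ext x
    simp only [Finset.mem_Icc, Finset.mem_map, Finset.mem_univ, true_and,
      Function.Embedding.coeFn_mk]
    constructor
    · rintro ⟨h1, h2⟩
      exact ⟨⟨x - 1, by omega⟩, by simp; omega⟩
    · rintro ⟨a, rfl⟩
      omega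
  rw [h1, Finset.map_val, Multiset.map_map]
  rfl

/-! ### Covariance of the fluctuation process in the eigenbasis -/

section Fluctuation

variable {Ω : Type*} [MeasurableSpace Ω] {P : Measure Ω} {N : ℕ} {z : Fin N → ℝ} {c : ℝ}
  {φ : ℝ → Fin N → ℝ} {B : Fin N → ℝ≥0 → Ω → ℝ} {W : ℝ≥0 → Ω → Fin N → ℝ}
  {Y : Fin N → ℝ → Ω → ℝ}

/-- Along an eigenvector of the interaction matrix, the fluctuation process is a Wiener integral. -/
lemma IsFluctuationProcess.dotProduct_eq (hz : IsOrderedHermiteZeros z) (hc : 0 < c)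
    (hφ : IsFrozenSolution φ (c • z)) (hW : IsFluctuationProcess φ B W P)
    (hYc : ∀ i ω, Continuous fun t => Y i t ω) (hY : ∀ᵐ ω ∂P, ∀ i t, Y i t ω = B i t.toNNReal ω)
    {μ : ℝ} {u : Fin N → ℝ} (hu : interactionMatrix z *ᵥ u = μ • u) (t : ℝ≥0) :
    ∀ᵐ ω ∂P, u ⬝ᵥ W t ω = (integratingFactor μ c t)⁻¹ *
      wienerIntegral (integratingFactor μ c) (integratingFactorDeriv μ c)
        (fun s ω => ∑ i, u i * Y i s ω) t ω := by
  filter_upwards [hW.continuous, hW.sde, hY] with ω hcont hsde hYω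
  have hWc : Continuous fun s : ℝ => W s.toNNReal ω := hcont.comp continuous_real_toNNReal
  have hWi : ∀ i, Continuous fun s : ℝ => W s.toNNReal ω i := fun i =>
    (continuous_apply i).comp hWc
  -- Symmetry moves the matrix onto the eigenvector, so the projected equation is closed and scalar.
  have hsym : ∀ x : Fin N → ℝ, u ⬝ᵥ (interactionMatrix z *ᵥ x) = μ * (u ⬝ᵥ x) := by
    intro x
    have hT : (interactionMatrix z)ᵀ = interactionMatrix z := by
      have := (isHermitian_interactionMatrix z).eq
      rwa [Matrix.conjTranspose_eq_transpose_of_trivial] at this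
    rw [Matrix.dotProduct_mulVec, ← Matrix.mulVec_transpose, hT, hu, smul_dotProduct, smul_eq_mul]
  have hint : ∀ s : ℝ, 0 ≤ s → u ⬝ᵥ W s.toNNReal ω = (∑ i, u i * Y i s ω)
      + ∫ r in (0 : ℝ)..s, μ * (2 * r + c ^ 2)⁻¹ * (u ⬝ᵥ W r.toNNReal ω) := by
    intro s hs
    have hus : Set.uIcc 0 s = Set.Icc 0 s := Set.uIcc_of_le hs
    have e1 : ∀ i, W s.toNNReal ω i = Y i s ω + ∫ r in (0 : ℝ)..s,
        (2 * r + c ^ 2)⁻¹ * (interactionMatrix z *ᵥ W r.toNNReal ω) i := by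
      intro i
      rw [hsde s.toNNReal i, hYω i s, Real.coe_toNNReal s hs]
      congr 1
      refine intervalIntegral.integral_congr fun r hr => ?_
      rw [hus] at hr
      simp only [interactionMatrix_frozenSolution hz hc hφ hr.1, Matrix.smul_mulVec,
        Pi.smul_apply, smul_eq_mul]
    have hii : ∀ i, IntervalIntegrable (fun r : ℝ =>
        (2 * r + c ^ 2)⁻¹ * (interactionMatrix z *ᵥ W r.toNNReal ω) i) volume 0 s := by
      intro i
      have : ContinuousOn (fun r : ℝ =>
          (2 * r + c ^ 2)⁻¹ * (interactionMatrix z *ᵥ W r.toNNReal ω) i) (Set.uIcc 0 s) := by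
        rw [hus]
        refine ((continuousOn_inv_time hc).mono Set.Icc_subset_Ici_self).mul ?_
        have : Continuous fun r : ℝ => (interactionMatrix z *ᵥ W r.toNNReal ω) i :=
          (continuous_apply i).comp (continuous_const.matrix_mulVec hWc)
        exact this.continuousOn
      exact this.intervalIntegrable
    rw [dotProduct]
    simp only [e1, mul_add]
    rw [Finset.sum_add_distrib]
    congr 1
    simp only [← intervalIntegral.integral_const_mul]
    rw [← intervalIntegral.integral_finsetSum fun i _ => (hii i).const_mul (u i)]
    refine intervalIntegral.integral_congr fun r _ => ?_
    have := hsym (W r.toNNReal ω)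
    simp only [dotProduct] at this
    simp only [mul_left_comm (u _), ← Finset.mul_sum, this, dotProduct]
    ring
  have key := integratingFactor_mul_eq (μ := μ) hc
    (w := fun s => u ⬝ᵥ W s.toNNReal ω) (β := fun s => ∑ i, u i * Y i s ω)
    (continuous_finsetSum _ fun i _ => continuous_const.mul (hWi i))
    (continuous_finsetSum _ fun i _ => continuous_const.mul (hYc i ω)) hint t.coe_nonneg
  simp only [Real.toNNReal_coe] at key
  rw [eq_inv_mul_iff_mul_eq₀ (integratingFactor_pos hc t.coe_nonneg).ne', key, wienerIntegral]

/-- The covariance matrix of the fluctuation process in an eigenbasis of the interaction matrix. -/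
lemma IsFluctuationProcess.memLp_and_covMatrix_eq [IsProbabilityMeasure P]
    (hz : IsOrderedHermiteZeros z) (hc : 0 < c)
    (hφ : IsFrozenSolution φ (c • z)) (hB : IsBrownianVec B P) (hW : IsFluctuationProcess φ B W P)
    {U : Matrix (Fin N) (Fin N) ℝ} {d : Fin N → ℝ} (hU : Uᵀ * U = 1)
    (hA : interactionMatrix z = U * Matrix.diagonal d * Uᵀ) (t : ℝ≥0) :
    (∀ i, MemLp (fun ω => W t ω i) 2 P) ∧
    covMatrix (W t) P = U * Matrix.diagonal (fun j => ((integratingFactor (d j) c t) ^ 2)⁻¹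
        * ∫ s in (0 : ℝ)..t, integratingFactor (d j) c s * integratingFactor (d j) c s) * Uᵀ := by
  obtain ⟨Y, hYm, hYc, hY⟩ := hB.exists_version
  have hcol : ∀ j, interactionMatrix z *ᵥ Uᵀ j = d j • Uᵀ j := by
    intro j
    have h : interactionMatrix z * U = U * Matrix.diagonal d := by
      rw [hA, mul_assoc, hU, mul_one]
    funext i
    have := congrFun (congrFun h i) j
    rw [Matrix.mul_diagonal, Matrix.mul_apply] at this
    simpa [Matrix.mulVec, dotProduct, mul_comm] using this
  set X : Fin N → ℝ → Ω → ℝ := fun j s ω => ∑ i, Uᵀ j i * Y i s ω with hX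
  set M : Fin N → Ω → ℝ := fun j => wienerIntegral (integratingFactor (d j) c)
    (integratingFactorDeriv (d j) c) (X j) t with hM
  have hXB : ∀ j, HasBrownianMoments (X j) P := fun j =>
    hB.hasBrownianMoments_sum hYm hYc hY (Uᵀ j)
  have hML : ∀ j, MemLp (M j) 2 P := fun j =>
    (hXB j).memLp_wienerIntegral t.coe_nonneg (continuousOn_integratingFactorDeriv hc)
  -- The isometry with `κ = Uᵀ j ⬝ᵥ Uᵀ l`, which is `0` off the diagonal since the columns of `U`
  -- are orthonormal.
  have hMcov : ∀ j l, cov[M j, M l; P] = if j = l then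
      ∫ s in (0 : ℝ)..t, integratingFactor (d j) c s * integratingFactor (d j) c s else 0 := by
    intro j l
    have hXX : ∀ s r, 0 ≤ s → 0 ≤ r →
        ∫ ω, X j s ω * X l r ω ∂P = (Uᵀ j ⬝ᵥ Uᵀ l) * min s r := fun s r hs hr =>
      hB.integral_sum_mul_sum hY _ _ hs hr
    have h1 : Uᵀ j ⬝ᵥ Uᵀ l = if j = l then 1 else 0 := by
      have := congrFun (congrFun hU j) l
      rwa [Matrix.mul_apply, Matrix.one_apply] at this
    rw [covariance_eq_sub (hML j) (hML l), (hXB j).integral_wienerIntegral t.coe_nonneg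
      (continuousOn_integratingFactorDeriv hc), zero_mul, sub_zero]
    have h2 := (hXB j).integral_wienerIntegral_mul_wienerIntegral (hXB l) hXX t.coe_nonneg
      (fun s hs => hasDerivAt_integratingFactor (μ := d j) hc hs.1)
      (continuousOn_integratingFactorDeriv hc)
      (fun s hs => hasDerivAt_integratingFactor (μ := d l) hc hs.1)
      (continuousOn_integratingFactorDeriv hc)
    simp only [Pi.mul_apply]
    rw [h2, h1]
    split_ifs with h
    · rw [h, one_mul]
    · rw [zero_mul]
  -- Expansion of `W t` in the orthonormal eigenbasis formed by the columns of `U`.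
  have hWM : ∀ i, (fun ω => W t ω i) =ᵐ[P]
      fun ω => ∑ j, (U i j * (integratingFactor (d j) c t)⁻¹) * M j ω := by
    intro i
    filter_upwards [ae_all_iff.2 fun j => hW.dotProduct_eq hz hc hφ hYc hY (hcol j) t] with ω hω
    have h1 : W t ω = U *ᵥ (Uᵀ *ᵥ W t ω) := by
      rw [Matrix.mulVec_mulVec, mul_eq_one_comm.1 hU, Matrix.one_mulVec]
    calc W t ω i = ∑ j, U i j * (Uᵀ j ⬝ᵥ W t ω) := congrFun h1 i
      _ = _ := Finset.sum_congr rfl fun j _ => by rw [hω j, mul_assoc]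
  have hcM : ∀ i j, MemLp (fun ω => (U i j * (integratingFactor (d j) c t)⁻¹) * M j ω) 2 P :=
    fun i j => (hML j).const_mul _
  refine ⟨fun i => (memLp_congr_ae (hWM i)).2 (memLp_finsetSum _ fun j _ => hcM i j), ?_⟩
  ext i k
  have hcc : cov[fun ω => W t ω i, fun ω => W t ω k; P]
      = cov[fun ω => ∑ j, (U i j * (integratingFactor (d j) c t)⁻¹) * M j ω,
        fun ω => ∑ j, (U k j * (integratingFactor (d j) c t)⁻¹) * M j ω; P] := by
    rw [covariance, covariance, integral_congr_ae (hWM i), integral_congr_ae (hWM k)]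
    refine integral_congr_ae ?_
    filter_upwards [hWM i, hWM k] with ω h1 h2
    rw [h1, h2]
  rw [covMatrix, Matrix.of_apply, hcc,
    covariance_fun_sum_fun_sum (fun j => hcM i j) (fun j => hcM k j), Matrix.mul_apply]
  refine Finset.sum_congr rfl fun j _ => ?_
  simp only [covariance_const_mul_left, covariance_const_mul_right, hMcov, mul_ite, mul_zero,
    Finset.sum_ite_eq, Finset.mem_univ, if_true]
  rw [Matrix.mul_diagonal, Matrix.transpose_apply]
  ring

end Fluctuation

end BesselA

end

theorem lemma2p5 {N : ℕ} (z : Fin N → ℝ) (hz : BesselA.IsOrderedHermiteZeros z)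
    (c : ℝ) (hc : 0 < c)
    (φ : ℝ → Fin N → ℝ) (hφ : BesselA.IsFrozenSolution φ (c • z))
    {Ω : Type*} [MeasurableSpace Ω] (P : Measure Ω) [IsProbabilityMeasure P]
    (B : Fin N → ℝ≥0 → Ω → ℝ) (hB : BesselA.IsBrownianVec B P)
    (W : ℝ≥0 → Ω → Fin N → ℝ) (hW : BesselA.IsFluctuationProcess φ B W P)
    (t : ℝ≥0) (ht : 0 < t) :
    (∀ i, MemLp (fun ω => W t ω i) 2 P) ∧
    IsUnit (1 - BesselA.interactionMatrix z) ∧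
    BesselA.covMatrix (W t) P =
      ((t : ℝ) + c ^ 2 / 2) •
        ((1 - BesselA.interactionMatrix z)⁻¹ *
          (1 - NormedSpace.exp
            (Real.log (c ^ 2 / (2 * (t : ℝ) + c ^ 2)) •
              (1 - BesselA.interactionMatrix z)))) ∧
    (BesselA.covMatrix (W t) P).charpoly.roots =
      (Finset.Icc 1 N).val.map (fun j => BesselA.covEigenvalue j t c) ∧
    BesselA.covEigenvalue 1 t c = t := by

  have hA := BesselA.isHermitian_interactionMatrix z
  have hev := BesselA.map_eigenvalues_interactionMatrix hz
  -- All eigenvalues are `-k ≤ 0`; hence `1 - μ > 0`, which gives both the invertibility and the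
  -- variance formula.
  have hlt : ∀ j, hA.eigenvalues j < 1 := by
    intro j
    have hmem : hA.eigenvalues j ∈ Finset.univ.val.map hA.eigenvalues :=
      Multiset.mem_map_of_mem _ (Finset.mem_univ j)
    rw [hev] at hmem
    obtain ⟨k, -, hk⟩ := Multiset.mem_map.1 hmem
    rw [← hk]
    have : (0 : ℝ) ≤ (k : ℕ) := Nat.cast_nonneg _
    linarith
  obtain ⟨U, hU, hAU⟩ := hA.exists_eq_conj_diagonal
  obtain ⟨hL, hcov⟩ := hW.memLp_and_covMatrix_eq hz hc hφ hB hU hAU t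
  simp only [BesselA.inv_sq_mul_integral_integratingFactor_sq hc t.coe_nonneg (hlt _)] at hcov
  have hsub : 1 - BesselA.interactionMatrix z
      = U * Matrix.diagonal (fun j => 1 - hA.eigenvalues j) * Uᵀ := by
    nth_rw 1 [hAU]
    exact BesselA.one_sub_conj_diagonal hU _
  have hinv := BesselA.conj_diagonal_mul_inv hU (d := fun j => 1 - hA.eigenvalues j)
    fun j => (sub_pos.2 (hlt j)).ne'
  refine ⟨hL, ?_, ?_, ?_, ?_⟩
  · rw [hsub]
    exact IsUnit.of_mul_eq_one _ hinv
  · rw [hcov, hsub, Matrix.inv_eq_right_inv hinv, BesselA.smul_conj_diagonal,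
      BesselA.exp_conj_diagonal hU, BesselA.one_sub_conj_diagonal hU, BesselA.conj_diagonal_mul hU,
      BesselA.smul_conj_diagonal]
  · rw [hcov, BesselA.roots_charpoly_conj_diagonal hU, BesselA.map_val_Icc_one]
    simp only [BesselA.covEigenvalue_succ hc t.coe_nonneg]
    -- The eigenvalues are known only as a multiset, so the variance function is applied to the
    -- multiset identity, not index by index.
    have := congrArg (Multiset.map fun μ : ℝ => ((t : ℝ) + c ^ 2 / 2) * ((1 - μ)⁻¹ *
      (1 - Real.exp (Real.log (c ^ 2 / (2 * (t : ℝ) + c ^ 2)) * (1 - μ))))) hev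
    simp only [Multiset.map_map] at this
    exact this
  · simp [BesselA.covEigenvalue]
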